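/- **Theorem 5.3.** *Model.* Let $\mathbb B$ be the closed Euclidean unit ball of $\mathbb R^d$. Two vectors $s,b\in\mathbb B$ are fixed and unknown to the learner. In each round $t=1,\dots,T$ the learner sees a context $x_t\in\mathbb B$ and posts a price $p_t$ to the seller, whose valuation is $\langle s,x_t\rangle$, and a price $q_t$ to the buyer, whose valuation is $\langle b,x_t\rangle$. It then observes the two bits $\mathbb 1\{\langle s,x_t\rangle\le p_t\}$ and $\mathbb 1\{q_t\le\langle b,x_t\rangle\}$ (two-bit feedback). The trade takes place if both bits are $1$; the profit of round $t$ is then $q_t-p_t$, and otherwise it is $0$. The regret is $\sum_{t=1}^T \max\{\langle b-s,x_t\rangle,0\}$ minus the total profit. *Pricing rule.* For $i=0,1,2,\dots$ let $z_i=2^{-3\cdot 2^i}/(16d)$. The confidence regions $S_t,B_t$ start at $S_1=B_1=\mathbb B$. After round $t$, $S_t$ is intersected with $\{v:\langle v,x_t\rangle\le p_t\}$ if the seller accepts and with $\{v:\langle v,x_t\rangle\ge p_t\}$ if the seller refuses; $B_t$ is intersected with $\{v:\langle v,x_t\rangle\ge q_t\}$ if the buyer accepts and with $\{v:\langle v,x_t\rangle\le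 q_t\}$ if the buyer refuses. Put $\overline s_t=\max_{v\in S_t}\langle v,x_t\rangle$, $\underline b_t=\min_{v\in B_t}\langle v,x_t\rangle$, and let $w^S_t,w^B_t$ be the widths $\max_v\langle v,x_t\rangle-\min_v\langle v,x_t\rangle$ of $S_t$ and $B_t$ along $x_t$. Let $i_t$ be the largest integer $i\ge 0$ with $\max\{w^S_t,w^B_t\}\le 2^{-2^i}$, or $i_t=0$ if there is none. The rule is: - if $\max\{w^S_t,w^B_t\}\le 1/T$, then $p_t=\overline s_t$ and $q_t=\max\{p_t,\underline b_t\}$; - otherwise, if $w^S_t\ge w^B_t$, then $p_t=m+z_{i_t}$ and $q_t=\max\{p_t,\underline b_t\}$, where $m$ solves $\mathrm{vol}\{v\in S_t+z_{i_t}\mathbb B:\langle v,x_t\rangle\ge m\}=2^{-2^{i_t-1}}\,\mathrm{vol}(S_t+z_{i_t}\mathbb B)$; - otherwise $q_t=m-z_{i_t}$ and $p_t=\min\{q_t,\overline s_t\}$, where $m$ solves $\mathrm{vol}\{v\in B_t+z_{i_t}\mathbb B:\langle v,x_t\rangle\le m\}=2^{-2^{i_t-1}}\,\mathrm{vol}(B_t+z_{i_t}\mathbb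 B)$. *Claim.* There is an absolute constant $C>0$ such that for all integers $d\ge 1$ and $T\ge 3$ there is a deterministic two-bit algorithm that follows this pricing rule and has the following properties for all $s,b\in\mathbb B$ and all contexts $x_1,\dots,x_T\in\mathbb B$. 1. It is per-round budget balanced: $p_t\le q_t$ for every $t\le T$. 2. Its regret is at most $C\,(d\log\log T+d\log d)$. 3. In every round of the second case, with $i=i_t$: if the seller refuses $p_t$, then $\mathrm{vol}(S_{t+1}+z_i\mathbb B)\le 2^{-2^{i-1}}\,\mathrm{vol}(S_t+z_i\mathbb B)$; if the seller accepts $p_t$, then $\mathrm{vol}(S_{t+1}+z_i\mathbb B)\le\bigl(1-\tfrac1{10\cdot 2^{2^{i-1}}}\bigr)\mathrm{vol}(S_t+z_i\mathbb B)$. In every round of the third case the same holds for the buyer, with $B_t$ and $q_t$ in place of $S_t$ and $p_t$. -/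

import Mathlib

open scoped Pointwise

noncomputable section

namespace ContextualTrade

/-- The space of contexts and of hidden weight vectors, with the Euclidean norm. -/
abbrev Vec (d : ℕ) := EuclideanSpace ℝ (Fin d)

/-! ### The two-bit interaction -/

/-- What the learner knows about one past round: the context, the two prices it posted, and the
two bits of feedback. -/
structure Round (d : ℕ) where
  context : Vec d
  sellerPrice : ℝ
  buyerPrice : ℝ
  sellerAccepts : Bool
  buyerAccepts : Bool

/-- A deterministic algorithm with two-bit feedback: from the past rounds and the current context
it computes the price for the seller and the price for the buyer. -/
abbrev TwoBitAlgorithm (d : ℕ) := List (Round d) → Vec d → ℝ × ℝ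

/-- The round that results from posting the prices `pq` on the context `x`, when the weight
vectors are `s` and `b`. -/
def playRound {d : ℕ} (s b x : Vec d) (pq : ℝ × ℝ) : Round d where
  context := x
  sellerPrice := pq.1
  buyerPrice := pq.2
  sellerAccepts := decide (inner ℝ s x ≤ pq.1)
  buyerAccepts := decide (pq.2 ≤ inner ℝ b x)

/-- The rounds played before time `t` (times are `0, 1, 2, …`), oldest first. -/
def history {d : ℕ} (A : TwoBitAlgorithm d) (s b : Vec d) (x : ℕ → Vec d) :
    ℕ → List (Round d)
  | 0 => []
  | t + 1 => history A s b x t ++ [playRound s b (x t) (A (history A s b x t) (x t))]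

/-- The price posted to the seller at time `t`. -/
def sellerPrice {d : ℕ} (A : TwoBitAlgorithm d) (s b : Vec d) (x : ℕ → Vec d) (t : ℕ) : ℝ :=
  (A (history A s b x t) (x t)).1

/-- The price posted to the buyer at time `t`. -/
def buyerPrice {d : ℕ} (A : TwoBitAlgorithm d) (s b : Vec d) (x : ℕ → Vec d) (t : ℕ) : ℝ :=
  (A (history A s b x t) (x t)).2

/-- The profit of the prices `p`, `q` when the valuations are `u` (seller) and `w` (buyer). -/
def profit (u w p q : ℝ) : ℝ := if u ≤ p ∧ q ≤ w then q - p else 0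

/-- The regret for profit over `T` rounds, against the best omniscient dynamic prices. -/
def profitRegret {d : ℕ} (A : TwoBitAlgorithm d) (s b : Vec d) (x : ℕ → Vec d) (T : ℕ) : ℝ :=
  ∑ t ∈ Finset.range T, max (inner ℝ b (x t) - inner ℝ s (x t)) 0 -
    ∑ t ∈ Finset.range T, profit (inner ℝ s (x t)) (inner ℝ b (x t))
      (sellerPrice A s b x t) (buyerPrice A s b x t)

/-! ### Confidence regions, widths, Steiner potentials -/

/-- The seller's confidence region: the part of the unit ball that agrees with the feedback,
where acceptance of `p` gives `⟨v, x⟩ ≤ p` and refusal gives `⟨v, x⟩ ≥ p`. -/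
def sellerRegion {d : ℕ} (h : List (Round d)) : Set (Vec d) :=
  {v | ‖v‖ ≤ 1 ∧ ∀ r ∈ h,
    if r.sellerAccepts then inner ℝ v r.context ≤ r.sellerPrice
    else r.sellerPrice ≤ inner ℝ v r.context}

/-- The buyer's confidence region: acceptance of `q` gives `⟨v, x⟩ ≥ q`, refusal `⟨v, x⟩ ≤ q`. -/
def buyerRegion {d : ℕ} (h : List (Round d)) : Set (Vec d) :=
  {v | ‖v‖ ≤ 1 ∧ ∀ r ∈ h,
    if r.buyerAccepts then r.buyerPrice ≤ inner ℝ v r.context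
    else inner ℝ v r.context ≤ r.buyerPrice}

/-- The largest value of `⟨v, x⟩` over `v ∈ K` (confidence regions are compact). -/
def upperEnd {d : ℕ} (K : Set (Vec d)) (x : Vec d) : ℝ := sSup ((fun v => inner ℝ v x) '' K)

/-- The smallest value of `⟨v, x⟩` over `v ∈ K`. -/
def lowerEnd {d : ℕ} (K : Set (Vec d)) (x : Vec d) : ℝ := sInf ((fun v => inner ℝ v x) '' K)

/-- The width of `K` along `x`. -/
def width {d : ℕ} (K : Set (Vec d)) (x : Vec d) : ℝ := upperEnd K x - lowerEnd K x

/-- The Minkowski sum of `K` and the ball of radius `z`. -/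
def fatten {d : ℕ} (K : Set (Vec d)) (z : ℝ) : Set (Vec d) := K + z • Metric.closedBall 0 1

/-- The Steiner potential of `K` at scale `z`. -/
def steiner {d : ℕ} (K : Set (Vec d)) (z : ℝ) : ℝ := MeasureTheory.volume.real (fatten K z)

/-! ### Unbalanced prices -/

/-- The scale `z_i = 2^{-3·2^i} / (16 d)`. -/
def scale (d i : ℕ) : ℝ := (2 : ℝ) ^ (-(3 * (2 : ℝ) ^ i)) / (16 * d)

/-- The fraction `2^{-2^{i-1}}` (for `i = 0` it is `2^{-1/2}`). -/
def fraction (i : ℕ) : ℝ := (2 : ℝ) ^ (-(2 : ℝ) ^ ((i : ℝ) - 1))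

/-- `i` is the largest natural number with `w ≤ 2^{-2^i}`, or `0` if there is none
(that is, if `w > 1/2`). -/
def IsIndex (w : ℝ) (i : ℕ) : Prop :=
  IsGreatest {j : ℕ | j = 0 ∨ w ≤ (2 : ℝ) ^ (-(2 : ℝ) ^ j)} i

/-- The level `m` cuts off, on the upper side along `x`, the fraction `2^{-2^{i-1}}` of the
volume of the fattened seller region. -/
def IsSellerCut {d : ℕ} (S : Set (Vec d)) (x : Vec d) (i : ℕ) (m : ℝ) : Prop :=
  MeasureTheory.volume.real {v | v ∈ fatten S (scale d i) ∧ m ≤ inner ℝ v x} =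
    fraction i * steiner S (scale d i)

/-- The level `m` cuts off, on the lower side along `x`, the fraction `2^{-2^{i-1}}` of the
volume of the fattened buyer region. -/
def IsBuyerCut {d : ℕ} (B : Set (Vec d)) (x : Vec d) (i : ℕ) (m : ℝ) : Prop :=
  MeasureTheory.volume.real {v | v ∈ fatten B (scale d i) ∧ inner ℝ v x ≤ m} =
    fraction i * steiner B (scale d i)

/-- Both widths are at most `1 / T`. -/
def SmallWidths {d : ℕ} (T : ℕ) (S B : Set (Vec d)) (x : Vec d) : Prop :=
  max (width S x) (width B x) ≤ 1 / (T : ℝ)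

/-- The seller's region is at least as wide as the buyer's, and wider than `1 / T`. -/
def SellerDominates {d : ℕ} (T : ℕ) (S B : Set (Vec d)) (x : Vec d) : Prop :=
  ¬ SmallWidths T S B x ∧ width B x ≤ width S x

/-- The buyer's region is wider than the seller's and wider than `1 / T`. -/
def BuyerDominates {d : ℕ} (T : ℕ) (S B : Set (Vec d)) (x : Vec d) : Prop :=
  ¬ SmallWidths T S B x ∧ width S x < width B x

/-- The pricing rule: safe prices if both widths are small; otherwise an unbalanced price for the
agent with the wider region and a safe price, capped by budget balance, for the other one. -/
def UsesUnbalancedPrices {d : ℕ} (T : ℕ) (A : TwoBitAlgorithm d) : Prop :=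
  ∀ (h : List (Round d)) (x : Vec d),
    (SmallWidths T (sellerRegion h) (buyerRegion h) x →
      (A h x).1 = upperEnd (sellerRegion h) x ∧
      (A h x).2 = max (A h x).1 (lowerEnd (buyerRegion h) x)) ∧
    (SellerDominates T (sellerRegion h) (buyerRegion h) x →
      ∃ i m, IsIndex (width (sellerRegion h) x) i ∧ IsSellerCut (sellerRegion h) x i m ∧
        (A h x).1 = m + scale d i ∧
        (A h x).2 = max (A h x).1 (lowerEnd (buyerRegion h) x)) ∧
    (BuyerDominates T (sellerRegion h) (buyerRegion h) x →
      ∃ i m, IsIndex (width (buyerRegion h) x) i ∧ IsBuyerCut (buyerRegion h) x i m ∧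
        (A h x).2 = m - scale d i ∧
        (A h x).1 = min (A h x).2 (upperEnd (sellerRegion h) x))

/-! ### The guarantees -/

/-- Per-round budget balance on an instance: `p_t ≤ q_t` in each of the `T` rounds. -/
def BudgetBalanced {d : ℕ} (A : TwoBitAlgorithm d) (s b : Vec d) (x : ℕ → Vec d) (T : ℕ) : Prop :=
  ∀ t < T, sellerPrice A s b x t ≤ buyerPrice A s b x t

/-- In a round that posts an unbalanced price to the seller at index `i`, the seller's potential
at scale `z_i` shrinks by the factor `2^{-2^{i-1}}` if the price is refused, and by the factor
`1 - 1 / (10 · 2^{2^{i-1}})` if it is accepted. -/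
def SellerPotentialShrinks {d : ℕ} (A : TwoBitAlgorithm d) (s b : Vec d) (x : ℕ → Vec d)
    (T : ℕ) : Prop :=
  ∀ t < T,
    SellerDominates T (sellerRegion (history A s b x t)) (buyerRegion (history A s b x t)) (x t) →
    ∀ i, IsIndex (width (sellerRegion (history A s b x t)) (x t)) i →
      (sellerPrice A s b x t < inner ℝ s (x t) →
        steiner (sellerRegion (history A s b x (t + 1))) (scale d i) ≤
          (2 : ℝ) ^ (-(2 : ℝ) ^ ((i : ℝ) - 1)) *
            steiner (sellerRegion (history A s b x t)) (scale d i)) ∧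
      (inner ℝ s (x t) ≤ sellerPrice A s b x t →
        steiner (sellerRegion (history A s b x (t + 1))) (scale d i) ≤
          (1 - 1 / (10 * (2 : ℝ) ^ ((2 : ℝ) ^ ((i : ℝ) - 1)))) *
            steiner (sellerRegion (history A s b x t)) (scale d i))

/-- The same for the buyer, in the rounds that post an unbalanced price to the buyer. -/
def BuyerPotentialShrinks {d : ℕ} (A : TwoBitAlgorithm d) (s b : Vec d) (x : ℕ → Vec d)
    (T : ℕ) : Prop :=
  ∀ t < T,
    BuyerDominates T (sellerRegion (history A s b x t)) (buyerRegion (history A s b x t)) (x t) →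
    ∀ i, IsIndex (width (buyerRegion (history A s b x t)) (x t)) i →
      (inner ℝ b (x t) < buyerPrice A s b x t →
        steiner (buyerRegion (history A s b x (t + 1))) (scale d i) ≤
          (2 : ℝ) ^ (-(2 : ℝ) ^ ((i : ℝ) - 1)) *
            steiner (buyerRegion (history A s b x t)) (scale d i)) ∧
      (buyerPrice A s b x t ≤ inner ℝ b (x t) →
        steiner (buyerRegion (history A s b x (t + 1))) (scale d i) ≤
          (1 - 1 / (10 * (2 : ℝ) ^ ((2 : ℝ) ^ ((i : ℝ) - 1)))) *
            steiner (buyerRegion (history A s b x t)) (scale d i))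

end ContextualTrade

end

open ContextualTrade

open scoped Pointwise
open ContextualTrade

namespace ContextualTrade

open MeasureTheory

/-! ### Slabs and cuts of convex bodies -/

/-! Regret is charged to the logarithms of the Steiner potentials. Write `f = 2^{-2^{i-1}}` for the
index `i` of the wider region, so that this region has width between `f^4` and `4 f^2`. A refused
unbalanced price confines the fattened region to the cut-off part, so its log-volume drops by at
least `2^{i-1} log 2`, while the round costs at most 2. An accepted price costs at most `9 f^2`,
since both widths are `O(f^2)`. It removes the cut-off part except for a slab of thickness `O(z_i)`;
because the width exceeds `f^4` and `z_i = f^6/(16d)`, the slab holds only the fraction `f^2/2` of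
the volume, and the log-volume still drops by `f/10` (`volume_slab_le`,
`IsSellerCut.steiner_le_of_accept`). As `f * 2^i ≤ 2`, the weight `180 / 2^i` on the potential at
scale `i` pays for both outcomes (`two_le_log_drop`, `nine_mul_sq_le_log_drop`). All potentials are
nonincreasing, so the drops telescope. At scale `i` each agent's total drop is at most `d (log (32
d) + 3 * 2^i * log 2)` (`log_steiner_sub_le`). After weighting, the first term sums geometrically
over `i` to `O(d log (32 d))`, and the second contributes `O(d)` for each of the `O(log log T)`
scales in use. Rounds with small widths cost `2/T` each. The buyer's case is the seller's reflected
by `x ↦ -x`. -/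

theorem measurable_inner_right {d : ℕ} (x : Vec d) : Measurable fun v : Vec d => inner ℝ v x :=
  (continuous_id.inner continuous_const).measurable

/-- The part of a convex body in a thin slab on one side of a point of the body. -/
theorem volume_slab_le_of_mem {d : ℕ} {K : Set (Vec d)} (hK : Convex ℝ K) (hm : MeasurableSet K)
    (hfin : volume K ≠ ⊤) {x u : Vec d} (hu : u ∈ K) {a δ : ℝ} (hδ : 0 ≤ δ)
    (hle : δ ≤ inner ℝ u x - a) (hpos : 0 < inner ℝ u x - a) :
    volume.real {v | v ∈ K ∧ a ≤ inner ℝ v x ∧ inner ℝ v x < a + δ} ≤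
      d * δ / (inner ℝ u x - a) * volume.real K := by
  set h := inner ℝ u x - a with hh
  set c : ℝ := 1 - δ / h with hc
  have hδh : δ / h ≤ 1 := (div_le_one hpos).2 hle
  have hδ0 : 0 ≤ δ / h := by positivity
  have hc0 : 0 ≤ c := by linarith
  have hfx := measurable_inner_right x
  set M : Set (Vec d) := {v | v ∈ K ∧ a ≤ inner ℝ v x}
  set M' : Set (Vec d) := {v | v ∈ K ∧ a + δ ≤ inner ℝ v x}
  set L : Set (Vec d) := {v | v ∈ K ∧ a ≤ inner ℝ v x ∧ inner ℝ v x < a + δ}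
  have hMK : M ⊆ K := fun v hv => hv.1
  have hM'K : M' ⊆ K := fun v hv => hv.1
  have hLK : L ⊆ K := fun v hv => hv.1
  have hM'm : MeasurableSet M' := hm.inter (measurableSet_le measurable_const hfx)
  have hfinM : volume M ≠ ⊤ := measure_ne_top_of_subset hMK hfin
  have hfinM' : volume M' ≠ ⊤ := measure_ne_top_of_subset hM'K hfin
  have hfinL : volume L ≠ ⊤ := measure_ne_top_of_subset hLK hfin
  have himg : AffineMap.homothety u c '' M ⊆ M' := by
    rintro _ ⟨v, ⟨hvK, hva⟩, rfl⟩
    have e : AffineMap.homothety u c v = c • v + (1 - c) • u := by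
      rw [AffineMap.homothety_apply]
      simp only [vsub_eq_sub, vadd_eq_add]
      module
    refine ⟨?_, ?_⟩
    · rw [e]
      exact hK hvK hu hc0 (by linarith) (by ring)
    · rw [e, inner_add_left, real_inner_smul_left, real_inner_smul_left]
      have h1 : c * a ≤ c * inner ℝ v x := mul_le_mul_of_nonneg_left hva hc0
      have h2 : (1 - c) * inner ℝ u x = (1 - c) * a + δ := by
        have : (1 - c) * h = δ := by rw [hc]; field_simp; ring
        rw [hh] at this
        linarith
      linarith
  have hvol : c ^ d * volume.real M ≤ volume.real M' := by
    have h1 : volume.real (AffineMap.homothety u c '' M) ≤ volume.real M' :=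
      measureReal_mono himg hfinM'
    rw [Measure.real, Measure.addHaar_image_homothety, ENNReal.toReal_mul,
      finrank_euclideanSpace_fin, ENNReal.toReal_ofReal (abs_nonneg _),
      abs_of_nonneg (pow_nonneg hc0 d)] at h1
    exact h1
  have hunion : volume.real L + volume.real M' = volume.real M := by
    rw [← measureReal_union _ hM'm hfinL hfinM']
    · congr 1
      ext v
      simp only [L, M, M', Set.mem_union, Set.mem_ofPred_eq]
      constructor
      · rintro (h | h)
        · exact ⟨h.1, h.2.1⟩
        · exact ⟨h.1, by linarith [h.2]⟩
      · rintro ⟨h1, h2⟩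
        rcases lt_or_ge (inner ℝ v x) (a + δ) with h3 | h3
        · exact Or.inl ⟨h1, h2, h3⟩
        · exact Or.inr ⟨h1, h3⟩
    · rw [Set.disjoint_left]
      intro v hv hv'
      exact absurd hv.2.2 (not_lt.2 hv'.2)
  have hbern : 1 - d * (δ / h) ≤ c ^ d := by
    have := one_add_mul_le_pow (a := c - 1) (by linarith) d
    have e : 1 + (c - 1) = c := by ring
    rw [e] at this
    have e2 : c - 1 = -(δ / h) := by rw [hc]; ring
    rw [e2] at this
    linarith
  have hM0 : 0 ≤ volume.real M := measureReal_nonneg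
  have hMV : volume.real M ≤ volume.real K := measureReal_mono hMK hfin
  calc volume.real L ≤ (d * (δ / h)) * volume.real M := by nlinarith
    _ ≤ (d * (δ / h)) * volume.real K := by gcongr
    _ = d * δ / h * volume.real K := by ring

/-- A slab of thickness `δ` contains at most the fraction `2dδ/W` of a convex body of width `W`. -/
theorem volume_slab_le {d : ℕ} (hd : 1 ≤ d) {K : Set (Vec d)} (hK : Convex ℝ K)
    (hm : MeasurableSet K) (hfin : volume K ≠ ⊤) {x u l : Vec d} (hu : u ∈ K) (hl : l ∈ K)
    {W : ℝ} (hW : 0 < W) (hul : W ≤ inner ℝ u x - inner ℝ l x) {a δ : ℝ} (hδ : 0 ≤ δ) :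
    volume.real {v | v ∈ K ∧ a < inner ℝ v x ∧ inner ℝ v x < a + δ} ≤
      2 * d * δ / W * volume.real K := by
  have hd' : (1 : ℝ) ≤ d := by exact_mod_cast hd
  have hV : 0 ≤ volume.real K := measureReal_nonneg
  rcases le_or_gt (W / 2) δ with hbig | hsmall
  -- For a thick slab the coefficient is at least 1 and the bound is trivial.
  · have h1 : 1 ≤ 2 * d * δ / W := by
      rw [le_div_iff₀ hW]
      nlinarith
    calc _ ≤ volume.real K := measureReal_mono (fun v hv => hv.1) hfin
      _ ≤ _ := by nlinarith
  have key : ∀ g : ℝ, W / 2 ≤ g → d * δ / g * volume.real K ≤ 2 * d * δ / W * volume.real K := by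
    intro g hg
    have : d * δ / g ≤ 2 * d * δ / W := by
      rw [div_le_div_iff₀ (by linarith) hW]
      have : 0 ≤ d * δ := by positivity
      nlinarith
    gcongr
  -- Either `u` lies at least `W/2` above the lower face of the slab, or `l` lies at least `W/2`
  -- below the upper face; the second case is reflected to the first.
  rcases le_or_gt (W / 2) (inner ℝ u x - a) with h1 | h1
  · refine le_trans (measureReal_mono ?_ (measure_ne_top_of_subset (fun v hv => hv.1) hfin))
      ((volume_slab_le_of_mem hK hm hfin hu hδ (by linarith) (by linarith)).trans (key _ h1))
    exact fun v hv => ⟨hv.1, hv.2.1.le, hv.2.2⟩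
  · have h2 : W / 2 ≤ inner ℝ l (-x) - (-(a + δ)) := by
      rw [inner_neg_right]
      linarith
    refine le_trans (measureReal_mono ?_ (measure_ne_top_of_subset (fun v hv => hv.1) hfin))
      ((volume_slab_le_of_mem hK hm hfin hl hδ (by linarith) (by linarith)).trans (key _ h2))
    rintro v ⟨hv, h3, h4⟩
    refine ⟨hv, ?_, ?_⟩ <;> rw [inner_neg_right] <;> linarith

/-- A hyperplane orthogonal to `x` can cut off any fraction of a convex body. -/
theorem exists_volume_cut {d : ℕ} (hd : 1 ≤ d) {K : Set (Vec d)} (hK : Convex ℝ K)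
    (hc : IsCompact K) {x u l : Vec d} (hu : u ∈ K) (hl : l ∈ K)
    (hul : inner ℝ l x < inner ℝ u x) {φ : ℝ} (hφ0 : 0 ≤ φ) (hφ1 : φ ≤ 1) :
    ∃ m : ℝ, volume.real {v | v ∈ K ∧ m ≤ inner ℝ v x} = φ * volume.real K := by
  have hm : MeasurableSet K := hc.measurableSet
  have hfin : volume K ≠ ⊤ := hc.measure_lt_top.ne
  have hV : 0 ≤ volume.real K := measureReal_nonneg
  have hfx := measurable_inner_right x
  set g : ℝ → ℝ := fun m => volume.real {v | v ∈ K ∧ m ≤ inner ℝ v x} with hg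
  set W := inner ℝ u x - inner ℝ l x with hW
  have hW0 : 0 < W := by linarith
  set Q : ℝ := 2 * d * 2 / W * volume.real K with hQ
  have hQ0 : 0 ≤ Q := by positivity
  have hfinm : ∀ m, volume {v | v ∈ K ∧ m ≤ inner ℝ v x} ≠ ⊤ := fun m =>
    measure_ne_top_of_subset (fun v hv => hv.1) hfin
  have hanti : Antitone g := fun m m' h =>
    measureReal_mono (fun v hv => ⟨hv.1, h.trans hv.2⟩) (hfinm m)
  have hlip : ∀ m m', m ≤ m' → g m - g m' ≤ Q * (m' - m) := by
    intro m m' hmm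
    rcases hmm.eq_or_lt with rfl | hlt
    · simp
    set δ := m' - m with hδ
    have hδ0 : 0 < δ := by linarith
    -- The slab is doubled because the estimate is for open slabs while level `m` itself must be
    -- covered; this is the extra factor 2 in `Q`.
    have hs := volume_slab_le hd hK hm hfin hu hl hW0 le_rfl (a := m - δ) (δ := 2 * δ)
      (by linarith)
    have hsub : {v | v ∈ K ∧ m ≤ inner ℝ v x} ⊆
        {v | v ∈ K ∧ m - δ < inner ℝ v x ∧ inner ℝ v x < m - δ + 2 * δ} ∪
          {v | v ∈ K ∧ m' ≤ inner ℝ v x} := by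
      rintro v ⟨hv, h1⟩
      rcases lt_or_ge (inner ℝ v x) m' with h2 | h2
      · exact Or.inl ⟨hv, by linarith, by linarith⟩
      · exact Or.inr ⟨hv, h2⟩
    have h1 : g m ≤ _ + g m' := (measureReal_mono hsub (measure_ne_top_of_subset
      (Set.union_subset (fun v hv => hv.1) (fun v hv => hv.1)) hfin)).trans
        (measureReal_union_le _ _)
    have : 2 * d * (2 * δ) / W * volume.real K = Q * δ := by rw [hQ]; ring
    linarith
  have hcont : Continuous g := by
    have : LipschitzWith (Real.toNNReal Q) g := by
      apply LipschitzWith.of_dist_le_mul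
      intro m m'
      rw [Real.coe_toNNReal _ hQ0, Real.dist_eq, Real.dist_eq]
      rcases le_total m m' with h | h
      · rw [abs_of_nonneg (sub_nonneg.2 (hanti h)), abs_of_nonpos (by linarith)]
        linarith [hlip m m' h]
      · rw [abs_of_nonpos (sub_nonpos.2 (hanti h)), abs_of_nonneg (by linarith)]
        linarith [hlip m' m h]
    exact this.continuous
  obtain ⟨R, hR⟩ := hc.exists_bound_of_continuousOn
    (f := fun v : Vec d => (inner ℝ v x : ℝ)) (by fun_prop)
  have hR' : ∀ v ∈ K, -R ≤ inner ℝ v x ∧ inner ℝ v x ≤ R := fun v hv => abs_le.1 (hR v hv)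
  have hlow : g (-R) = volume.real K := by
    simp only [hg]
    congr 1
    ext v
    exact ⟨fun h => h.1, fun h => ⟨h, (hR' v h).1⟩⟩
  have hhigh : g (R + 1) = 0 := by
    have : {v : Vec d | v ∈ K ∧ R + 1 ≤ inner ℝ v x} = ∅ := by
      ext v
      simp only [Set.mem_ofPred_eq, Set.mem_empty_iff_false, iff_false, not_and, not_le]
      intro hv
      linarith [(hR' v hv).2]
    simp only [hg, this, measureReal_empty]
  have hRR : -R ≤ R + 1 := by linarith [(hR' u hu).1, (hR' u hu).2]
  have hmem : φ * volume.real K ∈ Set.Icc (g (R + 1)) (g (-R)) := by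
    rw [hlow, hhigh]
    exact ⟨by positivity, by nlinarith⟩
  obtain ⟨m, -, h⟩ := intermediate_value_Icc' hRR hcont.continuousOn hmem
  exact ⟨m, h⟩

/-! ### Fattened sets -/

theorem mem_fatten {d : ℕ} {K : Set (Vec d)} {z : ℝ} (hz : 0 < z) {v : Vec d} :
    v ∈ fatten K z ↔ ∃ k ∈ K, ‖v - k‖ ≤ z := by
  unfold fatten
  rw [smul_closedBall z _ zero_le_one, smul_zero, mul_one, Real.norm_of_nonneg hz.le]
  constructor
  · rintro ⟨k, hk, e, he, rfl⟩
    exact ⟨k, hk, by simpa using he⟩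
  · rintro ⟨k, hk, h⟩
    exact ⟨k, hk, v - k, by simpa using h, by simp⟩

theorem isCompact_fatten {d : ℕ} {K : Set (Vec d)} (hK : IsCompact K) (z : ℝ) :
    IsCompact (fatten K z) :=
  hK.add ((isCompact_closedBall _ _).smul z)

theorem convex_fatten {d : ℕ} {K : Set (Vec d)} (hK : Convex ℝ K) (z : ℝ) :
    Convex ℝ (fatten K z) :=
  hK.add ((convex_closedBall _ _).smul z)

theorem subset_fatten {d : ℕ} {K : Set (Vec d)} {z : ℝ} (hz : 0 < z) : K ⊆ fatten K z :=
  fun v hv => (mem_fatten hz).2 ⟨v, hv, by simpa using hz.le⟩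

theorem fatten_mono {d : ℕ} {K K' : Set (Vec d)} (h : K ⊆ K') (z : ℝ) :
    fatten K z ⊆ fatten K' z :=
  Set.add_subset_add_right h

theorem steiner_mono {d : ℕ} {K K' : Set (Vec d)} (h : K ⊆ K') (hK' : IsCompact K') (z : ℝ) :
    steiner K z ≤ steiner K' z :=
  measureReal_mono (fatten_mono h z) (isCompact_fatten hK' z).measure_lt_top.ne

theorem abs_inner_sub_le {d : ℕ} {x v k : Vec d} {z : ℝ} (hx : ‖x‖ ≤ 1) (h : ‖v - k‖ ≤ z) :
    |(inner ℝ v x : ℝ) - inner ℝ k x| ≤ z := by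
  rw [← inner_sub_left]
  calc _ ≤ ‖v - k‖ * ‖x‖ := abs_real_inner_le_norm _ _
    _ ≤ ‖v - k‖ * 1 := by gcongr
    _ ≤ z := by linarith

theorem volume_closedBall_eq {d : ℕ} (c : Vec d) {r : ℝ} (hr : 0 ≤ r) :
    volume.real (Metric.closedBall c r) = r ^ d * volume.real (Metric.ball (0 : Vec d) 1) := by
  rw [Measure.real, Measure.addHaar_closedBall _ _ hr, ENNReal.toReal_mul,
    finrank_euclideanSpace_fin, ENNReal.toReal_ofReal (pow_nonneg hr d)]
  rfl

theorem volume_unitBall_pos (d : ℕ) : 0 < volume.real (Metric.ball (0 : Vec d) 1) :=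
  ENNReal.toReal_pos (Metric.measure_ball_pos _ _ one_pos).ne' measure_ball_lt_top.ne

theorem pow_mul_le_steiner {d : ℕ} {K : Set (Vec d)} (hK : IsCompact K)
    (hne : K.Nonempty) {z : ℝ} (hz : 0 < z) :
    z ^ d * volume.real (Metric.ball (0 : Vec d) 1) ≤ steiner K z := by
  obtain ⟨k, hk⟩ := hne
  rw [← volume_closedBall_eq k hz.le]
  refine measureReal_mono (fun v hv => (mem_fatten hz).2 ⟨k, hk, ?_⟩)
    (isCompact_fatten hK z).measure_lt_top.ne
  rwa [Metric.mem_closedBall, dist_eq_norm] at hv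

theorem steiner_pos {d : ℕ} {K : Set (Vec d)} (hK : IsCompact K)
    (hne : K.Nonempty) {z : ℝ} (hz : 0 < z) : 0 < steiner K z :=
  lt_of_lt_of_le (mul_pos (pow_pos hz d) (volume_unitBall_pos d)) (pow_mul_le_steiner hK hne hz)

theorem steiner_le_pow_mul {d : ℕ} {K : Set (Vec d)}
    (hK : K ⊆ Metric.closedBall 0 1) {z : ℝ} (hz : 0 < z) :
    steiner K z ≤ (1 + z) ^ d * volume.real (Metric.ball (0 : Vec d) 1) := by
  rw [← volume_closedBall_eq 0 (by linarith)]
  refine measureReal_mono (fun v hv => ?_) measure_closedBall_lt_top.ne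
  obtain ⟨k, hk, h⟩ := (mem_fatten hz).1 hv
  have h1 := hK hk
  rw [mem_closedBall_zero_iff] at h1 ⊢
  have := norm_le_norm_add_norm_sub' v k
  linarith

/-! ### Widths -/

theorem exists_upperEnd {d : ℕ} {K : Set (Vec d)} (hK : IsCompact K) (hne : K.Nonempty)
    (x : Vec d) : ∃ u ∈ K, inner ℝ u x = upperEnd K x := by
  have hc : ContinuousOn (fun v : Vec d => (inner ℝ v x : ℝ)) K := by fun_prop
  exact (hK.image_of_continuousOn hc).sSup_mem (hne.image _)

theorem exists_lowerEnd {d : ℕ} {K : Set (Vec d)} (hK : IsCompact K) (hne : K.Nonempty)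
    (x : Vec d) : ∃ u ∈ K, inner ℝ u x = lowerEnd K x := by
  have hc : ContinuousOn (fun v : Vec d => (inner ℝ v x : ℝ)) K := by fun_prop
  exact (hK.image_of_continuousOn hc).sInf_mem (hne.image _)

theorem le_upperEnd {d : ℕ} {K : Set (Vec d)} (hK : IsCompact K) (x : Vec d) {v : Vec d}
    (hv : v ∈ K) : inner ℝ v x ≤ upperEnd K x := by
  have hc : ContinuousOn (fun v : Vec d => (inner ℝ v x : ℝ)) K := by fun_prop
  exact le_csSup (hK.image_of_continuousOn hc).bddAbove ⟨v, hv, rfl⟩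

theorem lowerEnd_le {d : ℕ} {K : Set (Vec d)} (hK : IsCompact K) (x : Vec d) {v : Vec d}
    (hv : v ∈ K) : lowerEnd K x ≤ inner ℝ v x := by
  have hc : ContinuousOn (fun v : Vec d => (inner ℝ v x : ℝ)) K := by fun_prop
  exact csInf_le (hK.image_of_continuousOn hc).bddBelow ⟨v, hv, rfl⟩

theorem image_inner_neg {d : ℕ} (K : Set (Vec d)) (x : Vec d) :
    (fun v : Vec d => (inner ℝ v (-x) : ℝ)) '' K = -((fun v : Vec d => (inner ℝ v x : ℝ)) '' K) := by
  rw [← Set.image_neg_eq_neg, Set.image_image]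
  simp only [inner_neg_right]

theorem upperEnd_neg {d : ℕ} (K : Set (Vec d)) (x : Vec d) :
    upperEnd K (-x) = -lowerEnd K x := by
  rw [upperEnd, lowerEnd, image_inner_neg, Real.sInf_def, neg_neg]

theorem lowerEnd_neg {d : ℕ} (K : Set (Vec d)) (x : Vec d) :
    lowerEnd K (-x) = -upperEnd K x := by
  rw [← neg_neg x, upperEnd_neg, neg_neg, neg_neg]

theorem width_neg {d : ℕ} (K : Set (Vec d)) (x : Vec d) : width K (-x) = width K x := by
  rw [width, width, upperEnd_neg, lowerEnd_neg]
  ring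

/-- The real `sSup` and `sInf` of the empty set are both 0. The pricing rule covers arbitrary, even
inconsistent histories; a region of positive width is therefore nonempty. -/
theorem width_empty {d : ℕ} (x : Vec d) : width (∅ : Set (Vec d)) x = 0 := by
  simp [width, upperEnd, lowerEnd]

theorem isBuyerCut_iff {d : ℕ} {B : Set (Vec d)} {x : Vec d} {i : ℕ} {m : ℝ} :
    IsBuyerCut B x i m ↔ IsSellerCut B (-x) i (-m) := by
  simp only [IsBuyerCut, IsSellerCut, inner_neg_right, neg_le_neg_iff]

/-! ### Scales and indices -/

theorem fraction_pos (i : ℕ) : 0 < fraction i := Real.rpow_pos_of_pos two_pos _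

/-- Widths and scales become powers of `fraction i`, so later estimates are polynomial. -/
theorem fraction_pow (i k : ℕ) :
    fraction i ^ k = (2 : ℝ) ^ (-((k : ℝ) / 2 * (2 : ℝ) ^ i)) := by
  rw [fraction, ← Real.rpow_natCast, ← Real.rpow_mul two_pos.le, Real.rpow_sub two_pos,
    Real.rpow_natCast, Real.rpow_one]
  congr 1
  ring

theorem fraction_sq (i : ℕ) : fraction i ^ 2 = (2 : ℝ) ^ (-(2 : ℝ) ^ i) := by
  rw [fraction_pow]
  norm_num

theorem fraction_sq_le_half (i : ℕ) : fraction i ^ 2 ≤ 1 / 2 := by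
  rw [fraction_sq]
  calc (2 : ℝ) ^ (-(2 : ℝ) ^ i) ≤ (2 : ℝ) ^ (-1 : ℝ) :=
        Real.rpow_le_rpow_of_exponent_le one_le_two (neg_le_neg (one_le_pow₀ one_le_two))
    _ = 1 / 2 := by rw [Real.rpow_neg_one]; norm_num

theorem fraction_lt (i : ℕ) : fraction i < 3 / 4 := by
  nlinarith [fraction_sq_le_half i, fraction_pos i]

theorem scale_eq (d i : ℕ) : scale d i = fraction i ^ 6 / (16 * d) := by
  rw [scale, fraction_pow]
  norm_num

theorem scale_pos {d : ℕ} (hd : 1 ≤ d) (i : ℕ) : 0 < scale d i := by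
  have : (1 : ℝ) ≤ d := by exact_mod_cast hd
  rw [scale_eq]
  have := fraction_pos i
  positivity

theorem scale_le {d : ℕ} (hd : 1 ≤ d) (i : ℕ) : scale d i ≤ fraction i ^ 2 / 16 := by
  have hd' : (1 : ℝ) ≤ d := by exact_mod_cast hd
  have h0 := fraction_pos i
  have h1 : fraction i ^ 6 ≤ fraction i ^ 2 :=
    pow_le_pow_of_le_one h0.le (by linarith [fraction_lt i]) (by norm_num)
  rw [scale_eq, div_le_div_iff₀ (by positivity) (by norm_num)]
  nlinarith [pow_pos h0 2]

/-- Maximality excludes `i + 1`, and `2^{-2^{i+1}}` is `fraction i ^ 4`. -/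
theorem IsIndex.lt {w : ℝ} {i : ℕ} (h : IsIndex w i) : fraction i ^ 4 < w := by
  by_contra hcon
  have h1 : i + 1 ∈ {j : ℕ | j = 0 ∨ w ≤ (2 : ℝ) ^ (-(2 : ℝ) ^ j)} := by
    right
    refine (not_lt.1 hcon).trans_eq ?_
    rw [fraction_pow]
    congr 2
    push_cast
    ring
  exact absurd (h.2 h1) (by omega)

/-- The factor 4 is needed only for the default index 0, where `4 * fraction 0 ^ 2 = 2` is the
diameter of the unit ball. -/
theorem IsIndex.le {w : ℝ} {i : ℕ} (h : IsIndex w i) (hw : w ≤ 2) :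
    w ≤ 4 * fraction i ^ 2 := by
  rw [fraction_sq]
  rcases h.1 with rfl | h1
  · norm_num
    linarith
  · have : (0 : ℝ) < 2 ^ (-(2 : ℝ) ^ i) := Real.rpow_pos_of_pos two_pos _
    linarith

theorem two_pow_lt_of_two_rpow_lt {i T : ℕ}
    (h : 1 / (T : ℝ) < (2 : ℝ) ^ (-(2 : ℝ) ^ i)) (hT : 0 < T) : 2 ^ 2 ^ i < T := by
  have hT' : (0 : ℝ) < T := by exact_mod_cast hT
  rw [Real.rpow_neg two_pos.le, ← one_div, one_div_lt_one_div hT' (by positivity)] at h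
  have e : (2 : ℝ) ^ ((2 : ℝ) ^ i) = ((2 ^ 2 ^ i : ℕ) : ℝ) := by
    rw [← Real.rpow_natCast 2 i]
    push_cast
    rw [← Real.rpow_natCast 2 (2 ^ i)]
    push_cast
    rw [Real.rpow_natCast]
  rw [e] at h
  exact_mod_cast h

theorem exists_isIndex {w : ℝ} (hw : 0 < w) : ∃ i, IsIndex w i := by
  set P : Set ℕ := {j : ℕ | j = 0 ∨ w ≤ (2 : ℝ) ^ (-(2 : ℝ) ^ j)} with hP
  obtain ⟨n, hn⟩ := exists_nat_one_div_lt hw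
  have hb : BddAbove P := by
    refine ⟨n + 1, ?_⟩
    rintro j (rfl | hj)
    · omega
    · have h1 : 2 ^ 2 ^ j < n + 1 := two_pow_lt_of_two_rpow_lt
        (by push_cast; exact hn.trans_le hj) (by omega)
      have h2 : j < 2 ^ j := Nat.lt_two_pow_self
      have h3 : 2 ^ j < 2 ^ 2 ^ j := Nat.lt_two_pow_self
      omega
  exact ⟨sSup P, Nat.sSup_mem ⟨0, Or.inl rfl⟩ hb, fun j hj => le_csSup hb hj⟩

theorem IsIndex.le_log {w : ℝ} {i T : ℕ} (h : IsIndex w i) (hT : 0 < T) (hw : 1 / (T : ℝ) < w) :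
    i ≤ Nat.log 2 (Nat.log 2 T) := by
  rcases h.1 with rfl | h1
  · exact Nat.zero_le _
  · have h2 : 2 ^ 2 ^ i < T := two_pow_lt_of_two_rpow_lt (hw.trans_le h1) hT
    exact Nat.le_log_of_pow_le one_lt_two (Nat.le_log_of_pow_le one_lt_two h2.le)

/-! ### Unbalanced cuts -/

theorem exists_isSellerCut {d : ℕ} (hd : 1 ≤ d) {S : Set (Vec d)} (hc : Convex ℝ S)
    (hS : IsCompact S) {x : Vec d} (hw : 0 < width S x) (i : ℕ) : ∃ m, IsSellerCut S x i m := by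
  have hne : S.Nonempty := by
    rw [Set.nonempty_iff_ne_empty]
    rintro rfl
    rw [width_empty] at hw
    exact lt_irrefl _ hw
  obtain ⟨u, hu, hu'⟩ := exists_upperEnd hS hne x
  obtain ⟨l, hl, hl'⟩ := exists_lowerEnd hS hne x
  have hz := scale_pos hd i
  exact exists_volume_cut hd (convex_fatten hc _) (isCompact_fatten hS _)
    (subset_fatten hz hu) (subset_fatten hz hl) (by rw [hu', hl']; rw [width] at hw; linarith)
    (fraction_pos i).le (by linarith [fraction_lt i])

/-- A higher level would cut off nothing, whereas the prescribed fraction is positive. This limits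
how far an accepted price can overshoot the valuation. -/
theorem IsSellerCut.le_upperEnd {d : ℕ} (hd : 1 ≤ d) {S : Set (Vec d)}
    (hS : IsCompact S) (hne : S.Nonempty) {x : Vec d} (hx : ‖x‖ ≤ 1) {i : ℕ} {m : ℝ}
    (hm : IsSellerCut S x i m) : m ≤ upperEnd S x + scale d i := by
  by_contra hcon
  have hz := scale_pos hd i
  have hempty : {v : Vec d | v ∈ fatten S (scale d i) ∧ m ≤ inner ℝ v x} = ∅ := by
    rw [Set.eq_empty_iff_forall_notMem]
    rintro v ⟨hv, hmv⟩
    obtain ⟨k, hk, h⟩ := (mem_fatten hz).1 hv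
    have := (abs_le.1 (abs_inner_sub_le hx h)).2
    have := ContextualTrade.le_upperEnd hS x hk
    linarith
  have := mul_pos (fraction_pos i) (steiner_pos hS hne hz)
  rw [IsSellerCut, hempty, measureReal_empty] at hm
  linarith

/-- The offset `z` in the price absorbs the fattening: points within `z` of the remaining region
stay above `m`. -/
theorem IsSellerCut.steiner_le_of_refuse {d : ℕ} (hd : 1 ≤ d) {S S' : Set (Vec d)}
    (hS : IsCompact S) {x : Vec d} (hx : ‖x‖ ≤ 1) {i : ℕ} {m : ℝ} (hm : IsSellerCut S x i m)
    (hsub : S' ⊆ S) (hS' : ∀ v ∈ S', m + scale d i ≤ inner ℝ v x) :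
    steiner S' (scale d i) ≤ fraction i * steiner S (scale d i) := by
  have hz := scale_pos hd i
  rw [← hm]
  refine measureReal_mono (fun v hv => ⟨fatten_mono hsub _ hv, ?_⟩) (measure_ne_top_of_subset
    (fun v hv => hv.1) (isCompact_fatten hS (scale d i)).measure_lt_top.ne)
  obtain ⟨k, hk, h⟩ := (mem_fatten hz).1 hv
  have := (abs_le.1 (abs_inner_sub_le hx h)).1
  have := hS' k hk
  linarith

theorem IsSellerCut.steiner_le_of_accept {d : ℕ} (hd : 1 ≤ d) {S S' : Set (Vec d)}
    (hc : Convex ℝ S) (hS : IsCompact S) (hne : S.Nonempty) {x : Vec d} (hx : ‖x‖ ≤ 1) {i : ℕ}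
    {m : ℝ} (hi : IsIndex (width S x) i) (hm : IsSellerCut S x i m)
    (hsub : S' ⊆ S) (hS' : ∀ v ∈ S', inner ℝ v x ≤ m + scale d i) :
    steiner S' (scale d i) ≤ (1 - fraction i / 10) * steiner S (scale d i) := by
  have hd' : (1 : ℝ) ≤ d := by exact_mod_cast hd
  have hz := scale_pos hd i
  have hzeq := scale_eq d i
  have hf0 := fraction_pos i
  have hf1 := fraction_lt i
  set z := scale d i
  set f := fraction i
  set K := fatten S z
  have hK : IsCompact K := isCompact_fatten hS z
  have hfin : volume K ≠ ⊤ := hK.measure_lt_top.ne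
  obtain ⟨u, hu, hu'⟩ := exists_upperEnd hS hne x
  obtain ⟨l, hl, hl'⟩ := exists_lowerEnd hS hne x
  have hwid : f ^ 4 ≤ inner ℝ u x - inner ℝ l x := by
    rw [hu', hl']
    exact hi.lt.le
  -- The fattened remainder reaches at most level `m + 2z`; the open slab from `m - z` to `m + 3z`
  -- contains all of `[m, m + 2z]`.
  have hslab := volume_slab_le hd (convex_fatten hc z) hK.measurableSet hfin
    (subset_fatten hz hu) (subset_fatten hz hl) (by positivity) hwid (a := m - z)
    (δ := 4 * z) (by linarith)
  have hcoef : 2 * d * (4 * z) / f ^ 4 = f ^ 2 / 2 := by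
    rw [hzeq]
    field_simp
    ring
  rw [hcoef] at hslab
  have hlow : volume.real {v | v ∈ K ∧ inner ℝ v x < m} = volume.real K - f * volume.real K := by
    have hmeas : MeasurableSet {v : Vec d | v ∈ K ∧ m ≤ inner ℝ v x} :=
      hK.measurableSet.inter (measurableSet_le measurable_const (measurable_inner_right x))
    have h1 := measureReal_union (μ := volume) (s₁ := {v : Vec d | v ∈ K ∧ inner ℝ v x < m})
      (by
        rw [Set.disjoint_left]
        intro v hv hv'
        exact absurd hv.2 (not_lt.2 hv'.2)) hmeas
      (measure_ne_top_of_subset (fun v hv => hv.1) hfin)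
      (measure_ne_top_of_subset (fun v hv => hv.1) hfin)
    have h2 : {v : Vec d | v ∈ K ∧ inner ℝ v x < m} ∪ {v : Vec d | v ∈ K ∧ m ≤ inner ℝ v x} = K := by
      ext v
      constructor
      · rintro (h | h) <;> exact h.1
      · intro h
        rcases lt_or_ge (inner ℝ v x) m with h3 | h3
        · exact Or.inl ⟨h, h3⟩
        · exact Or.inr ⟨h, h3⟩
    rw [h2, hm] at h1
    change volume.real K = _ + f * volume.real K at h1
    linarith
  have hcover : fatten S' z ⊆ {v | v ∈ K ∧ inner ℝ v x < m} ∪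
      {v | v ∈ K ∧ m - z < inner ℝ v x ∧ inner ℝ v x < m - z + 4 * z} := by
    intro v hv
    have hvK : v ∈ K := fatten_mono hsub _ hv
    obtain ⟨k, hk, h⟩ := (mem_fatten hz).1 hv
    have h1 := (abs_le.1 (abs_inner_sub_le hx h)).2
    have h2 := hS' k hk
    rcases lt_or_ge (inner ℝ v x) m with h3 | h3
    · exact Or.inl ⟨hvK, h3⟩
    · exact Or.inr ⟨hvK, by linarith, by linarith⟩
  have h1 : steiner S' z ≤ _ + _ := (measureReal_mono hcover (measure_ne_top_of_subset
    (Set.union_subset (fun v hv => hv.1) (fun v hv => hv.1)) hfin)).trans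
      (measureReal_union_le _ _)
  rw [hlow] at h1
  have hV : 0 ≤ volume.real K := measureReal_nonneg
  have h3 : f ^ 2 / 2 ≤ f * (9 / 10) := by nlinarith
  have h4 : f ^ 2 / 2 * volume.real K ≤ f * (9 / 10) * volume.real K := by gcongr
  change steiner S' z ≤ (1 - f / 10) * volume.real K
  linarith

/-! ### Confidence regions -/

/-- An arbitrary bit `c` lets one statement serve both agents; the buyer's bit enters negated. -/
theorem convex_and_isCompact_region {d : ℕ} (h : List (Round d)) (c : Round d → Bool)
    (p : Round d → ℝ) :
    Convex ℝ {v : Vec d | ‖v‖ ≤ 1 ∧ ∀ r ∈ h,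
      if c r then inner ℝ v r.context ≤ p r else p r ≤ inner ℝ v r.context} ∧
    IsCompact {v : Vec d | ‖v‖ ≤ 1 ∧ ∀ r ∈ h,
      if c r then inner ℝ v r.context ≤ p r else p r ≤ inner ℝ v r.context} := by
  set H : Round d → Set (Vec d) := fun r =>
    {v | if c r then inner ℝ v r.context ≤ p r else p r ≤ inner ℝ v r.context} with hH
  have e : {v : Vec d | ‖v‖ ≤ 1 ∧ ∀ r ∈ h,
      if c r then inner ℝ v r.context ≤ p r else p r ≤ inner ℝ v r.context} =
      Metric.closedBall 0 1 ∩ ⋂ r ∈ h, H r := by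
    ext v
    simp [hH]
  have hlin : ∀ r : Round d, IsLinearMap ℝ fun v : Vec d => (inner ℝ v r.context : ℝ) := fun r =>
    ⟨fun v w => inner_add_left v w _, fun a v => real_inner_smul_left v _ a⟩
  have hconv : ∀ r, Convex ℝ (H r) := by
    intro r
    cases hr : c r
    · simpa [hH, hr] using convex_halfSpace_ge (hlin r) (p r)
    · simpa [hH, hr] using convex_halfSpace_le (hlin r) (p r)
  have hclosed : ∀ r, IsClosed (H r) := by
    intro r
    cases hr : c r
    · simpa [hH, hr] using isClosed_le continuous_const
        (continuous_id.inner continuous_const : Continuous fun v : Vec d => inner ℝ v r.context)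
    · simpa [hH, hr] using isClosed_le
        (continuous_id.inner continuous_const : Continuous fun v : Vec d => inner ℝ v r.context)
        continuous_const
  rw [e]
  exact ⟨(convex_closedBall 0 1).inter (convex_iInter₂ fun r _ => hconv r),
    (isCompact_closedBall 0 1).inter_right
      (isClosed_iInter fun r => isClosed_iInter fun _ => hclosed r)⟩

theorem buyerRegion_eq {d : ℕ} (h : List (Round d)) :
    buyerRegion h = {v : Vec d | ‖v‖ ≤ 1 ∧ ∀ r ∈ h,
      if !r.buyerAccepts then inner ℝ v r.context ≤ r.buyerPrice
      else r.buyerPrice ≤ inner ℝ v r.context} := by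
  have e : ∀ (v : Vec d) (r : Round d),
      (if !r.buyerAccepts then inner ℝ v r.context ≤ r.buyerPrice
        else r.buyerPrice ≤ inner ℝ v r.context) =
      (if r.buyerAccepts then r.buyerPrice ≤ inner ℝ v r.context
        else inner ℝ v r.context ≤ r.buyerPrice) := by
    intro v r
    cases r.buyerAccepts <;> rfl
  simp only [e]
  rfl

theorem convex_sellerRegion {d : ℕ} (h : List (Round d)) : Convex ℝ (sellerRegion h) :=
  (convex_and_isCompact_region h (·.sellerAccepts) (·.sellerPrice)).1

theorem isCompact_sellerRegion {d : ℕ} (h : List (Round d)) : IsCompact (sellerRegion h) :=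
  (convex_and_isCompact_region h (·.sellerAccepts) (·.sellerPrice)).2

theorem convex_buyerRegion {d : ℕ} (h : List (Round d)) : Convex ℝ (buyerRegion h) := by
  rw [buyerRegion_eq]
  exact (convex_and_isCompact_region h (! ·.buyerAccepts) (·.buyerPrice)).1

theorem isCompact_buyerRegion {d : ℕ} (h : List (Round d)) : IsCompact (buyerRegion h) := by
  rw [buyerRegion_eq]
  exact (convex_and_isCompact_region h (! ·.buyerAccepts) (·.buyerPrice)).2

theorem sellerRegion_subset {d : ℕ} (h : List (Round d)) :
    sellerRegion h ⊆ Metric.closedBall 0 1 :=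
  fun _ hv => mem_closedBall_zero_iff.2 hv.1

theorem buyerRegion_subset {d : ℕ} (h : List (Round d)) :
    buyerRegion h ⊆ Metric.closedBall 0 1 :=
  fun _ hv => mem_closedBall_zero_iff.2 hv.1

/-! ### Evolution of the confidence regions during play -/

section Dynamics

variable {d : ℕ} (A : TwoBitAlgorithm d) (s b : Vec d) (x : ℕ → Vec d) (t : ℕ)

theorem mem_sellerRegion_history_succ {v : Vec d} :
    v ∈ sellerRegion (history A s b x (t + 1)) ↔ v ∈ sellerRegion (history A s b x t) ∧
      if inner ℝ s (x t) ≤ sellerPrice A s b x t then inner ℝ v (x t) ≤ sellerPrice A s b x t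
      else sellerPrice A s b x t ≤ inner ℝ v (x t) := by
  by_cases h : inner ℝ s (x t) ≤ sellerPrice A s b x t
  · rw [if_pos h]
    unfold sellerPrice at h ⊢
    simp only [sellerRegion, history, List.mem_append, List.mem_singleton, Set.mem_ofPred_eq,
      or_imp, forall_and, forall_eq, playRound, h, and_assoc,
      decide_true, if_true]
  · rw [if_neg h]
    unfold sellerPrice at h ⊢
    simp only [sellerRegion, history, List.mem_append, List.mem_singleton, Set.mem_ofPred_eq,
      or_imp, forall_and, forall_eq, playRound, h, and_assoc,
      decide_false, Bool.false_eq_true, if_false]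

theorem mem_buyerRegion_history_succ {v : Vec d} :
    v ∈ buyerRegion (history A s b x (t + 1)) ↔ v ∈ buyerRegion (history A s b x t) ∧
      if buyerPrice A s b x t ≤ inner ℝ b (x t) then buyerPrice A s b x t ≤ inner ℝ v (x t)
      else inner ℝ v (x t) ≤ buyerPrice A s b x t := by
  by_cases h : buyerPrice A s b x t ≤ inner ℝ b (x t)
  · rw [if_pos h]
    unfold buyerPrice at h ⊢
    simp only [buyerRegion, history, List.mem_append, List.mem_singleton, Set.mem_ofPred_eq,
      or_imp, forall_and, forall_eq, playRound, h, and_assoc,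
      decide_true, if_true]
  · rw [if_neg h]
    unfold buyerPrice at h ⊢
    simp only [buyerRegion, history, List.mem_append, List.mem_singleton, Set.mem_ofPred_eq,
      or_imp, forall_and, forall_eq, playRound, h, and_assoc,
      decide_false, Bool.false_eq_true, if_false]

theorem sellerRegion_history_succ_subset :
    sellerRegion (history A s b x (t + 1)) ⊆ sellerRegion (history A s b x t) :=
  fun _ hv => ((mem_sellerRegion_history_succ A s b x t).1 hv).1

theorem buyerRegion_history_succ_subset :
    buyerRegion (history A s b x (t + 1)) ⊆ buyerRegion (history A s b x t) :=
  fun _ hv => ((mem_buyerRegion_history_succ A s b x t).1 hv).1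

variable {s b} in
theorem mem_sellerRegion_history (hs : ‖s‖ ≤ 1) : s ∈ sellerRegion (history A s b x t) := by
  induction t with
  | zero => exact ⟨hs, by simp [history]⟩
  | succ t ih =>
    refine (mem_sellerRegion_history_succ A s b x t).2 ⟨ih, ?_⟩
    split_ifs with h
    · exact h
    · exact (not_le.1 h).le

variable {s b} in
theorem mem_buyerRegion_history (hb : ‖b‖ ≤ 1) : b ∈ buyerRegion (history A s b x t) := by
  induction t with
  | zero => exact ⟨hb, by simp [history]⟩
  | succ t ih =>
    refine (mem_buyerRegion_history_succ A s b x t).2 ⟨ih, ?_⟩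
    split_ifs with h
    · exact h
    · exact (not_le.1 h).le

end Dynamics

/-! ### Shrinking of the potentials along the play -/

theorem one_sub_eq_fraction (i : ℕ) :
    1 - 1 / (10 * (2 : ℝ) ^ ((2 : ℝ) ^ ((i : ℝ) - 1))) = 1 - fraction i / 10 := by
  rw [fraction, Real.rpow_neg two_pos.le]
  field_simp

theorem sellerPotentialShrinks {d T : ℕ} (hd : 1 ≤ d) {A : TwoBitAlgorithm d}
    (hA : UsesUnbalancedPrices T A) {s b : Vec d} {x : ℕ → Vec d} (hs : ‖s‖ ≤ 1)
    (hx : ∀ t < T, ‖x t‖ ≤ 1) : SellerPotentialShrinks A s b x T := by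
  intro t ht hdom i hi
  obtain ⟨j, m, hj, hm, hp, -⟩ := (hA _ _).2.1 hdom
  obtain rfl := hj.unique hi
  rw [one_sub_eq_fraction]
  have hsub := sellerRegion_history_succ_subset A s b x t
  have hc := isCompact_sellerRegion (history A s b x t)
  refine ⟨fun h => ?_, fun h => ?_⟩
  · refine hm.steiner_le_of_refuse hd hc (hx t ht) hsub fun v hv => ?_
    have := ((mem_sellerRegion_history_succ A s b x t).1 hv).2
    rw [if_neg (not_le.2 h)] at this
    exact hp ▸ this
  · refine hm.steiner_le_of_accept hd (convex_sellerRegion _) hc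
      ⟨s, mem_sellerRegion_history A x t hs⟩ (hx t ht) hi hsub fun v hv => ?_
    have := ((mem_sellerRegion_history_succ A s b x t).1 hv).2
    rw [if_pos h] at this
    exact hp ▸ this

theorem buyerPotentialShrinks {d T : ℕ} (hd : 1 ≤ d) {A : TwoBitAlgorithm d}
    (hA : UsesUnbalancedPrices T A) {s b : Vec d} {x : ℕ → Vec d} (hb : ‖b‖ ≤ 1)
    (hx : ∀ t < T, ‖x t‖ ≤ 1) : BuyerPotentialShrinks A s b x T := by
  intro t ht hdom i hi
  obtain ⟨j, m, hj, hm, hq, -⟩ := (hA _ _).2.2 hdom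
  obtain rfl := hj.unique hi
  rw [one_sub_eq_fraction]
  rw [isBuyerCut_iff] at hm
  have hsub := buyerRegion_history_succ_subset A s b x t
  have hc := isCompact_buyerRegion (history A s b x t)
  have hx' : ‖-x t‖ ≤ 1 := by rw [norm_neg]; exact hx t ht
  change buyerPrice A s b x t = _ at hq
  refine ⟨fun h => ?_, fun h => ?_⟩
  · refine hm.steiner_le_of_refuse hd hc hx' hsub fun v hv => ?_
    have := ((mem_buyerRegion_history_succ A s b x t).1 hv).2
    rw [if_neg (not_le.2 h)] at this
    rw [inner_neg_right]
    linarith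
  · refine hm.steiner_le_of_accept hd (convex_buyerRegion _) hc
      ⟨b, mem_buyerRegion_history A x t hb⟩ hx' (by rwa [width_neg]) hsub fun v hv => ?_
    have := ((mem_buyerRegion_history_succ A s b x t).1 hv).2
    rw [if_pos h] at this
    rw [inner_neg_right]
    linarith

/-! ### Existence of the algorithm and budget balance -/

theorem pos_of_not_smallWidths {d T : ℕ} {S B : Set (Vec d)} {x : Vec d}
    (h : ¬ SmallWidths T S B x) : 1 / (T : ℝ) < max (width S x) (width B x) := not_le.1 h

theorem exists_usesUnbalancedPrices {d : ℕ} (hd : 1 ≤ d) (T : ℕ) :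
    ∃ A : TwoBitAlgorithm d, UsesUnbalancedPrices T A := by
  have hT : (0 : ℝ) ≤ 1 / (T : ℝ) := by positivity
  have key : ∀ (h : List (Round d)) (x : Vec d), ∃ pq : ℝ × ℝ,
      (SmallWidths T (sellerRegion h) (buyerRegion h) x →
        pq.1 = upperEnd (sellerRegion h) x ∧ pq.2 = max pq.1 (lowerEnd (buyerRegion h) x)) ∧
      (SellerDominates T (sellerRegion h) (buyerRegion h) x →
        ∃ i m, IsIndex (width (sellerRegion h) x) i ∧ IsSellerCut (sellerRegion h) x i m ∧
          pq.1 = m + scale d i ∧ pq.2 = max pq.1 (lowerEnd (buyerRegion h) x)) ∧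
      (BuyerDominates T (sellerRegion h) (buyerRegion h) x →
        ∃ i m, IsIndex (width (buyerRegion h) x) i ∧ IsBuyerCut (buyerRegion h) x i m ∧
          pq.2 = m - scale d i ∧ pq.1 = min pq.2 (upperEnd (sellerRegion h) x)) := by
    intro h x
    by_cases h1 : SmallWidths T (sellerRegion h) (buyerRegion h) x
    · exact ⟨(upperEnd (sellerRegion h) x, max (upperEnd (sellerRegion h) x)
        (lowerEnd (buyerRegion h) x)), fun _ => ⟨rfl, rfl⟩, fun h2 => absurd h1 h2.1, fun h2 => absurd h1 h2.1⟩
    have hlt := pos_of_not_smallWidths h1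
    rcases le_or_gt (width (buyerRegion h) x) (width (sellerRegion h) x) with h2 | h2
    · rw [max_eq_left h2] at hlt
      obtain ⟨i, hi⟩ := exists_isIndex (hT.trans_lt hlt)
      obtain ⟨m, hm⟩ := exists_isSellerCut hd (convex_sellerRegion h)
        (isCompact_sellerRegion h) (hT.trans_lt hlt) i
      exact ⟨(m + scale d i, max (m + scale d i) (lowerEnd (buyerRegion h) x)), fun h3 => absurd h3 h1, fun _ => ⟨i, m, hi, hm, rfl, rfl⟩,
        fun h3 => absurd h3.2 (not_lt.2 h2)⟩
    · rw [max_eq_right h2.le] at hlt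
      obtain ⟨i, hi⟩ := exists_isIndex (hT.trans_lt hlt)
      obtain ⟨m, hm⟩ := exists_isSellerCut hd (convex_buyerRegion h)
        (isCompact_buyerRegion h) (x := -x) (by rw [width_neg]; exact hT.trans_lt hlt) i
      refine ⟨(min (-m - scale d i) (upperEnd (sellerRegion h) x), -m - scale d i),
        fun h3 => absurd h3 h1, fun h3 => absurd h3.2 (not_le.2 h2),
        fun _ => ⟨i, -m, hi, ?_, rfl, rfl⟩⟩
      rwa [isBuyerCut_iff, neg_neg]
  choose A hA using key
  exact ⟨A, hA⟩

theorem smallWidths_or_dominates {d : ℕ} (T : ℕ) (S B : Set (Vec d)) (x : Vec d) :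
    SmallWidths T S B x ∨ SellerDominates T S B x ∨ BuyerDominates T S B x := by
  by_cases h : SmallWidths T S B x
  · exact Or.inl h
  · rcases le_or_gt (width B x) (width S x) with h2 | h2
    · exact Or.inr (Or.inl ⟨h, h2⟩)
    · exact Or.inr (Or.inr ⟨h, h2⟩)

theorem budgetBalanced {d T : ℕ} {A : TwoBitAlgorithm d} (hA : UsesUnbalancedPrices T A)
    (s b : Vec d) (x : ℕ → Vec d) : BudgetBalanced A s b x T := by
  intro t _
  obtain ⟨h1, h2, h3⟩ := hA (history A s b x t) (x t)
  change (A _ _).1 ≤ (A _ _).2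
  rcases smallWidths_or_dominates T (sellerRegion (history A s b x t))
    (buyerRegion (history A s b x t)) (x t) with h | h | h
  · exact (le_max_left _ _).trans_eq (h1 h).2.symm
  · obtain ⟨_, _, _, _, _, h4⟩ := h2 h
    exact (le_max_left _ _).trans_eq h4.symm
  · obtain ⟨_, _, _, _, _, h4⟩ := h3 h
    exact h4.trans_le (min_le_left _ _)

/-! ### Regret of a single round -/

/-- If the trade takes place, the loss splits into `(w - q) + (p - u)`. If the buyer refuses, then
`lb ≤ w` forces `q = p`, so `w < p` and the lost gain is below `p - u`. -/
theorem regret_le_of_seller_accepts {u w p q lb W E : ℝ} (hq : q = max p lb) (hlb : lb ≤ w)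
    (hW : w ≤ lb + W) (hu : u ≤ p) (hE : p - u ≤ E) :
    max (w - u) 0 - profit u w p q ≤ W + E := by
  have h1 : p ≤ q := hq ▸ le_max_left _ _
  have h2 : lb ≤ q := hq ▸ le_max_right _ _
  unfold profit
  split_ifs with h
  · rcases max_cases (w - u) 0 with ⟨e, -⟩ | ⟨e, -⟩ <;> rw [e] <;> linarith
  · have h3 : w < q := not_le.1 fun h' => h ⟨hu, h'⟩
    have h4 : w < p := by
      rcases max_cases p lb with ⟨e, -⟩ | ⟨e, -⟩ <;> rw [e] at hq <;> linarith
    rcases max_cases (w - u) 0 with ⟨e, -⟩ | ⟨e, -⟩ <;> rw [e] <;> linarith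

theorem regret_le_of_buyer_accepts {u w p q ub W E : ℝ} (hp : p = min q ub) (hub : u ≤ ub)
    (hW : ub ≤ u + W) (hw : q ≤ w) (hE : w - q ≤ E) :
    max (w - u) 0 - profit u w p q ≤ W + E := by
  have h1 : p ≤ q := hp ▸ min_le_left _ _
  have h2 : p ≤ ub := hp ▸ min_le_right _ _
  unfold profit
  split_ifs with h
  · rcases max_cases (w - u) 0 with ⟨e, -⟩ | ⟨e, -⟩ <;> rw [e] <;> linarith
  · have h3 : p < u := not_le.1 fun h' => h ⟨h', hw⟩
    have h4 : q < u := by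
      rcases min_cases q ub with ⟨e, -⟩ | ⟨e, -⟩ <;> rw [e] at hp <;> linarith
    rcases max_cases (w - u) 0 with ⟨e, -⟩ | ⟨e, -⟩ <;> rw [e] <;> linarith

theorem regret_le_two {u w p q : ℝ} (hu : |u| ≤ 1) (hw : |w| ≤ 1)
    (h : ¬(u ≤ p ∧ q ≤ w)) : max (w - u) 0 - profit u w p q ≤ 2 := by
  rw [profit, if_neg h, sub_zero]
  have := (abs_le.1 hu).1
  have := (abs_le.1 hw).2
  exact max_le (by linarith) (by norm_num)

/-! ### Charging regret to the logarithmic potentials -/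

theorem fraction_mul_two_pow_le (i : ℕ) : fraction i * 2 ^ i ≤ 2 := by
  cases i with
  | zero => linarith [fraction_lt 0]
  | succ j =>
    have h0 : (2 : ℝ) ^ j ≤ 2 ^ (2 : ℝ) ^ j := by
      have h1 : (2 : ℝ) ^ j < 2 ^ 2 ^ j := by exact_mod_cast Nat.lt_two_pow_self (n := 2 ^ j)
      have h2 : (2 : ℝ) ^ (2 : ℝ) ^ j = 2 ^ 2 ^ j := by
        rw [← Real.rpow_natCast 2 (2 ^ j)]
        push_cast
        rfl
      exact h1.le.trans_eq h2.symm
    have e : fraction (j + 1) = (2 ^ (2 : ℝ) ^ j)⁻¹ := by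
      rw [fraction, ← Real.rpow_neg two_pos.le]
      push_cast
      rw [add_sub_cancel_right, Real.rpow_natCast]
    rw [e, pow_succ, ← mul_assoc]
    have : (2 ^ (2 : ℝ) ^ j)⁻¹ * (2 : ℝ) ^ j ≤ 1 := by
      rw [inv_mul_le_iff₀ (by positivity), mul_one]
      exact h0
    linarith

theorem log_fraction (i : ℕ) : Real.log (fraction i) = -(2 ^ i / 2 * Real.log 2) := by
  rw [fraction, Real.log_rpow two_pos, Real.rpow_sub two_pos, Real.rpow_natCast, Real.rpow_one]
  ring

/-- The price of a refused unbalanced offer is paid by the drop of the logarithmic potential. -/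
theorem two_le_log_drop {i : ℕ} {V V' : ℝ} (hV' : 0 < V') (hV : 0 < V)
    (h : V' ≤ fraction i * V) : 2 ≤ 180 / 2 ^ i * (Real.log V - Real.log V') := by
  have h1 : Real.log V' ≤ Real.log (fraction i) + Real.log V := by
    rw [← Real.log_mul (fraction_pos i).ne' hV.ne']
    exact Real.log_le_log hV' h
  rw [log_fraction] at h1
  have h2 : 2 ^ i / 2 * Real.log 2 ≤ Real.log V - Real.log V' := by linarith
  have h3 := Real.log_two_gt_d9
  calc (2 : ℝ) ≤ 90 * Real.log 2 := by linarith
    _ = 180 / 2 ^ i * (2 ^ i / 2 * Real.log 2) := by field_simp; norm_num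
    _ ≤ _ := by gcongr

/-- This case dictates the constant 180: `18 f / 2^i ≥ 9 f^2` is exactly `f * 2^i ≤ 2`. Refusals
leave ample slack. -/
theorem nine_mul_sq_le_log_drop {i : ℕ} {V V' : ℝ} (hV' : 0 < V') (hV : 0 < V)
    (h : V' ≤ (1 - fraction i / 10) * V) :
    9 * fraction i ^ 2 ≤ 180 / 2 ^ i * (Real.log V - Real.log V') := by
  have hf := fraction_pos i
  have hf1 := fraction_lt i
  have h1 : Real.log V' ≤ Real.log (1 - fraction i / 10) + Real.log V := by
    rw [← Real.log_mul (by linarith) hV.ne']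
    exact Real.log_le_log hV' h
  have h2 := Real.log_le_sub_one_of_pos (show 0 < 1 - fraction i / 10 by linarith)
  have h3 : fraction i / 10 ≤ Real.log V - Real.log V' := by linarith
  calc 9 * fraction i ^ 2 ≤ 180 / 2 ^ i * (fraction i / 10) := by
        rw [div_mul_eq_mul_div, le_div_iff₀ (by positivity)]
        nlinarith [fraction_mul_two_pow_le i]
    _ ≤ _ := by gcongr

theorem width_le_two {d : ℕ} {K : Set (Vec d)} (hK : IsCompact K)
    (hsub : K ⊆ Metric.closedBall 0 1) (hne : K.Nonempty) {x : Vec d} (hx : ‖x‖ ≤ 1) :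
    width K x ≤ 2 := by
  obtain ⟨u, hu, hu'⟩ := exists_upperEnd hK hne x
  obtain ⟨l, hl, hl'⟩ := exists_lowerEnd hK hne x
  have key : ∀ v ∈ K, |(inner ℝ v x : ℝ)| ≤ 1 := by
    intro v hv
    have := abs_inner_sub_le hx (k := 0) (v := v) (z := 1)
      (by simpa using hsub hv)
    simpa using this
  have := (abs_le.1 (key u hu)).2
  have := (abs_le.1 (key l hl)).1
  rw [width, ← hu', ← hl']
  linarith

/-- The drop, in one round, of the logarithmic potentials of both agents over the first `N`
scales, weighted by the regret that each unit of potential pays for. -/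
noncomputable def potentialDrop {d : ℕ} (A : TwoBitAlgorithm d) (s b : Vec d) (x : ℕ → Vec d) (N t : ℕ) : ℝ :=
  ∑ i ∈ Finset.range N, 180 / 2 ^ i *
    ((Real.log (steiner (sellerRegion (history A s b x t)) (scale d i)) -
        Real.log (steiner (sellerRegion (history A s b x (t + 1))) (scale d i))) +
      (Real.log (steiner (buyerRegion (history A s b x t)) (scale d i)) -
        Real.log (steiner (buyerRegion (history A s b x (t + 1))) (scale d i))))

theorem regret_round_le {d T : ℕ} (hd : 1 ≤ d) (hT : 0 < T) {A : TwoBitAlgorithm d}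
    (hA : UsesUnbalancedPrices T A) {s b : Vec d} {x : ℕ → Vec d} (hs : ‖s‖ ≤ 1) (hb : ‖b‖ ≤ 1)
    (hx : ∀ t < T, ‖x t‖ ≤ 1) {t : ℕ} (ht : t < T) :
    max (inner ℝ b (x t) - inner ℝ s (x t)) 0 - profit (inner ℝ s (x t)) (inner ℝ b (x t))
      (sellerPrice A s b x t) (buyerPrice A s b x t) ≤
    2 / T + potentialDrop A s b x (Nat.log 2 (Nat.log 2 T) + 1) t := by
  have hT' : (0 : ℝ) < T := by exact_mod_cast hT
  have hshS := sellerPotentialShrinks hd hA (b := b) hs hx t ht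
  have hshB := buyerPotentialShrinks hd hA (s := s) hb hx t ht
  have hsS := mem_sellerRegion_history A (b := b) x t hs
  have hbB := mem_buyerRegion_history A (s := s) x t hb
  have hsS' := mem_sellerRegion_history A (b := b) x (t + 1) hs
  have hbB' := mem_buyerRegion_history A (s := s) x (t + 1) hb
  have hSsub := sellerRegion_history_succ_subset A s b x t
  have hBsub := buyerRegion_history_succ_subset A s b x t
  have hSb := sellerRegion_subset (history A s b x t)
  have hBb := buyerRegion_subset (history A s b x t)
  have hSc := isCompact_sellerRegion (history A s b x t)
  have hBc := isCompact_buyerRegion (history A s b x t)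
  have hSc' := isCompact_sellerRegion (history A s b x (t + 1))
  have hBc' := isCompact_buyerRegion (history A s b x (t + 1))
  obtain ⟨hA1, hA2, hA3⟩ := hA (history A s b x t) (x t)
  have hxt := hx t ht
  unfold potentialDrop
  unfold sellerPrice buyerPrice at *
  set S := sellerRegion (history A s b x t)
  set B := buyerRegion (history A s b x t)
  set S' := sellerRegion (history A s b x (t + 1))
  set B' := buyerRegion (history A s b x (t + 1))
  set p := (A (history A s b x t) (x t)).1
  set q := (A (history A s b x t) (x t)).2
  set u : ℝ := inner ℝ s (x t)
  set w : ℝ := inner ℝ b (x t)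
  have hS0 : ∀ i, 0 < steiner S (scale d i) := fun i => steiner_pos hSc ⟨s, hsS⟩ (scale_pos hd i)
  have hB0 : ∀ i, 0 < steiner B (scale d i) := fun i => steiner_pos hBc ⟨b, hbB⟩ (scale_pos hd i)
  have hS0' : ∀ i, 0 < steiner S' (scale d i) :=
    fun i => steiner_pos hSc' ⟨s, hsS'⟩ (scale_pos hd i)
  have hB0' : ∀ i, 0 < steiner B' (scale d i) :=
    fun i => steiner_pos hBc' ⟨b, hbB'⟩ (scale_pos hd i)
  have hDS : ∀ i, 0 ≤ Real.log (steiner S (scale d i)) - Real.log (steiner S' (scale d i)) :=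
    fun i => sub_nonneg.2 (Real.log_le_log (hS0' i) (steiner_mono hSsub hSc _))
  have hDB : ∀ i, 0 ≤ Real.log (steiner B (scale d i)) - Real.log (steiner B' (scale d i)) :=
    fun i => sub_nonneg.2 (Real.log_le_log (hB0' i) (steiner_mono hBsub hBc _))
  set DS : ℕ → ℝ := fun i => Real.log (steiner S (scale d i)) - Real.log (steiner S' (scale d i))
  set DB : ℕ → ℝ := fun i => Real.log (steiner B (scale d i)) - Real.log (steiner B' (scale d i))
  change _ ≤ 2 / (T : ℝ) + ∑ i ∈ Finset.range _, 180 / 2 ^ i * (DS i + DB i)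
  have hterm : ∀ i, 0 ≤ 180 / 2 ^ i * (DS i + DB i) := fun i =>
    mul_nonneg (by positivity) (add_nonneg (hDS i) (hDB i))
  have hT2 : 0 ≤ 2 / (T : ℝ) := by positivity
  -- All terms are nonnegative, so one agent's drop at one scale may pay for the round.
  have hpay : ∀ i, i ≤ Nat.log 2 (Nat.log 2 T) → ∀ r : ℝ,
      r ≤ 180 / 2 ^ i * DS i ∨ r ≤ 180 / 2 ^ i * DB i →
      r ≤ 2 / (T : ℝ) +
        ∑ i ∈ Finset.range (Nat.log 2 (Nat.log 2 T) + 1), 180 / 2 ^ i * (DS i + DB i) := by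
    intro i hi r hr
    have h1 := Finset.single_le_sum (fun i _ => hterm i)
      (Finset.mem_range.2 (Nat.lt_succ_of_le hi))
    have h2 : 0 ≤ 180 / 2 ^ i * DS i := mul_nonneg (by positivity) (hDS i)
    have h3 : 0 ≤ 180 / 2 ^ i * DB i := mul_nonneg (by positivity) (hDB i)
    have h4 : r ≤ 180 / 2 ^ i * (DS i + DB i) := by
      rw [mul_add]
      rcases hr with h | h <;> linarith
    have h5 := h4.trans h1
    linarith
  have habs : ∀ v : Vec d, ‖v‖ ≤ 1 → |(inner ℝ v (x t) : ℝ)| ≤ 1 := by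
    intro v hv
    have := abs_inner_sub_le hxt (k := 0) (v := v) (z := 1) (by simpa using hv)
    simpa using this
  have hu1 : u ≤ upperEnd S (x t) := le_upperEnd hSc _ hsS
  have hu2 : lowerEnd S (x t) ≤ u := lowerEnd_le hSc _ hsS
  have hw1 : w ≤ upperEnd B (x t) := le_upperEnd hBc _ hbB
  have hw2 : lowerEnd B (x t) ≤ w := lowerEnd_le hBc _ hbB
  have hWS : width S (x t) = upperEnd S (x t) - lowerEnd S (x t) := rfl
  have hWB : width B (x t) = upperEnd B (x t) - lowerEnd B (x t) := rfl
  rcases smallWidths_or_dominates T S B (x t) with h | h | h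
  · obtain ⟨hp, hq⟩ := hA1 h
    have h1 : width S (x t) ≤ 1 / T := (le_max_left _ _).trans h
    have h2 : width B (x t) ≤ 1 / T := (le_max_right _ _).trans h
    have h3 := regret_le_of_seller_accepts (W := 1 / T) (E := 1 / T) hq hw2 (by linarith)
      (hu1.trans_eq hp.symm) (by rw [hp]; linarith)
    have h4 := Finset.sum_nonneg fun i (_ : i ∈ Finset.range (Nat.log 2 (Nat.log 2 T) + 1)) =>
      hterm i
    have h5 : (1 : ℝ) / T + 1 / T = 2 / T := by ring
    linarith
  · obtain ⟨i, m, hi, hm, hp, hq⟩ := hA2 h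
    have hlt := pos_of_not_smallWidths h.1
    rw [max_eq_left h.2] at hlt
    refine hpay i (hi.le_log hT hlt) _ (Or.inl ?_)
    obtain ⟨href, hacc⟩ := hshS h i hi
    rcases lt_or_ge p u with hpu | hup
    · exact (regret_le_two (habs s hs) (habs b hb) fun h' => absurd h'.1 (not_le.2 hpu)).trans
        (two_le_log_drop (hS0' i) (hS0 i) (href hpu))
    · have hacc := hacc hup
      rw [one_sub_eq_fraction] at hacc
      refine le_trans ?_ (nine_mul_sq_le_log_drop (hS0' i) (hS0 i) hacc)
      have hw := hi.le (width_le_two hSc hSb ⟨s, hsS⟩ hxt)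
      have hmu := hm.le_upperEnd hd hSc ⟨s, hsS⟩ hxt
      have hz := scale_le hd i
      have hdom := h.2
      -- The total is at most `4 f^2 + 4 f^2 + 2 f^2/16`, hence below `9 f^2`.
      have h3 := regret_le_of_seller_accepts (W := width B (x t))
        (E := width S (x t) + 2 * scale d i) hq hw2 (by linarith) hup (by linarith)
      linarith [sq_nonneg (fraction i)]
  · obtain ⟨i, m, hi, hm, hq, hp⟩ := hA3 h
    have hlt := pos_of_not_smallWidths h.1
    rw [max_eq_right h.2.le] at hlt
    refine hpay i (hi.le_log hT hlt) _ (Or.inr ?_)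
    obtain ⟨href, hacc⟩ := hshB h i hi
    rcases lt_or_ge w q with hpu | hup
    · exact (regret_le_two (habs s hs) (habs b hb) fun h' => absurd h'.2 (not_le.2 hpu)).trans
        (two_le_log_drop (hB0' i) (hB0 i) (href hpu))
    · have hacc := hacc hup
      rw [one_sub_eq_fraction] at hacc
      refine le_trans ?_ (nine_mul_sq_le_log_drop (hB0' i) (hB0 i) hacc)
      have hw := hi.le (width_le_two hBc hBb ⟨b, hbB⟩ hxt)
      have hmu := (isBuyerCut_iff.1 hm).le_upperEnd hd hBc ⟨b, hbB⟩ (by rwa [norm_neg])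
      rw [upperEnd_neg] at hmu
      have hz := scale_le hd i
      have hdom := h.2
      have h3 := regret_le_of_buyer_accepts (W := width S (x t))
        (E := width B (x t) + 2 * scale d i) hp hu1 (by linarith) hup (by linarith)
      linarith [sq_nonneg (fraction i)]

/-! ### Total regret -/

/-- The fattened `K` lies in a ball of radius `1 + z ≤ 2` and the fattened `K'` contains one of
radius `z`, so the ratio is at most `(2/z)^d`. -/
theorem log_steiner_sub_le {d : ℕ} (hd : 1 ≤ d) {K K' : Set (Vec d)} (hK : IsCompact K)
    (hsub : K ⊆ Metric.closedBall 0 1) (hK' : IsCompact K') (hne : K.Nonempty)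
    (hne' : K'.Nonempty) (i : ℕ) :
    Real.log (steiner K (scale d i)) - Real.log (steiner K' (scale d i)) ≤
      d * (Real.log (32 * d) + 3 * 2 ^ i * Real.log 2) := by
  have hd' : (1 : ℝ) ≤ d := by exact_mod_cast hd
  have hz := scale_pos hd i
  have hz1 : scale d i ≤ 1 := by linarith [scale_le hd i, fraction_sq_le_half i]
  have hv := volume_unitBall_pos d
  set v := volume.real (Metric.ball (0 : Vec d) 1)
  have h1 : Real.log (steiner K (scale d i)) ≤ d * Real.log 2 + Real.log v := by
    rw [← Real.log_pow, ← Real.log_mul (by positivity) hv.ne']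
    refine Real.log_le_log (steiner_pos hK hne hz) ((steiner_le_pow_mul hsub hz).trans ?_)
    gcongr
    linarith
  have h2 : d * Real.log (scale d i) + Real.log v ≤ Real.log (steiner K' (scale d i)) := by
    rw [← Real.log_pow, ← Real.log_mul (by positivity) hv.ne']
    exact Real.log_le_log (by positivity) (pow_mul_le_steiner hK' hne' hz)
  have h3 : Real.log (scale d i) = -(3 * 2 ^ i) * Real.log 2 - Real.log (16 * d) := by
    rw [scale, Real.log_div (by positivity) (by positivity), Real.log_rpow two_pos]
  have h4 : Real.log (32 * d) = Real.log 2 + Real.log (16 * d) := by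
    rw [← Real.log_mul (by norm_num) (by positivity)]
    congr 1
    ring
  rw [h3] at h2
  rw [h4]
  linarith

theorem log_log_three_ge : (8 / 100 : ℝ) ≤ Real.log (Real.log 3) := by
  have he := Real.exp_one_lt_d9
  have h1 : (109 / 100 : ℝ) ≤ Real.log 3 := by
    have h2 := Real.one_sub_inv_le_log_of_pos (show 0 < 3 / Real.exp 1 by positivity)
    rw [Real.log_div (by norm_num) (by positivity), Real.log_exp, inv_div] at h2
    linarith
  have h3 := Real.one_sub_inv_le_log_of_pos (show 0 < Real.log 3 by linarith)
  have h4 : (Real.log 3)⁻¹ ≤ (109 / 100 : ℝ)⁻¹ := inv_anti₀ (by norm_num) h1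
  norm_num at h4
  linarith

/-- For `d = 1` the term `d log d` vanishes, so additive multiples of `d` must be absorbed by `d log
log T`; this needs a positive lower bound. -/
theorem le_log_log {T : ℕ} (hT : 3 ≤ T) : (8 / 100 : ℝ) ≤ Real.log (Real.log T) := by
  have h3 : (3 : ℝ) ≤ T := by exact_mod_cast hT
  refine log_log_three_ge.trans (Real.log_le_log (Real.log_pos (by norm_num)) ?_)
  exact Real.log_le_log (by norm_num) h3

theorem natLog_natLog_le {T : ℕ} (hT : 3 ≤ T) :
    ((Nat.log 2 (Nat.log 2 T) : ℕ) : ℝ) * Real.log 2 ≤ Real.log (Real.log T) + 1 := by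
  have hlog2 := Real.log_two_gt_d9
  have hM : Nat.log 2 T ≠ 0 := (Nat.log_pos one_lt_two (by omega)).ne'
  have h1 : ((2 : ℝ) ^ Nat.log 2 (Nat.log 2 T)) ≤ Nat.log 2 T := by
    exact_mod_cast Nat.pow_log_le_self 2 hM
  have h2 : ((2 : ℝ) ^ Nat.log 2 T) ≤ T := by
    exact_mod_cast Nat.pow_log_le_self 2 (show T ≠ 0 by omega)
  have h3 : (Nat.log 2 T : ℝ) * Real.log 2 ≤ Real.log T := by
    rw [← Real.log_pow]
    exact Real.log_le_log (by positivity) h2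
  have h4 : ((2 : ℝ) ^ Nat.log 2 (Nat.log 2 T)) ≤ Real.log T / Real.log 2 := by
    rw [le_div_iff₀ (by linarith)]
    nlinarith
  have hTlog : 0 < Real.log T := Real.log_pos (by exact_mod_cast (show 1 < T by omega))
  have h5 := Real.log_le_log (by positivity) h4
  rw [Real.log_pow, Real.log_div hTlog.ne' (by linarith)] at h5
  -- The additive 1 in the claim covers `-log (log 2)`.
  have h6 := Real.one_sub_inv_le_log_of_pos (show 0 < Real.log 2 by linarith)
  have h7 : (Real.log 2)⁻¹ ≤ 2 := by
    rw [inv_le_comm₀ (by linarith) two_pos]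
    linarith
  linarith

theorem sum_potentialDrop_le {d : ℕ} (hd : 1 ≤ d) (A : TwoBitAlgorithm d) {s b : Vec d}
    (x : ℕ → Vec d) (hs : ‖s‖ ≤ 1) (hb : ‖b‖ ≤ 1) (N T : ℕ) :
    ∑ t ∈ Finset.range T, potentialDrop A s b x N t ≤
      720 * (d * Real.log (32 * d)) + 1080 * (d * (N * Real.log 2)) := by
  have hd' : (1 : ℝ) ≤ d := by exact_mod_cast hd
  have hl : 0 ≤ Real.log (32 * d) := Real.log_nonneg (by linarith)
  unfold potentialDrop
  rw [Finset.sum_comm]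
  have h1 : ∀ i ∈ Finset.range N, ∑ t ∈ Finset.range T, 180 / 2 ^ i *
      ((Real.log (steiner (sellerRegion (history A s b x t)) (scale d i)) -
          Real.log (steiner (sellerRegion (history A s b x (t + 1))) (scale d i))) +
        (Real.log (steiner (buyerRegion (history A s b x t)) (scale d i)) -
          Real.log (steiner (buyerRegion (history A s b x (t + 1))) (scale d i)))) ≤
      360 * (d * Real.log (32 * d)) * (1 / 2) ^ i + 1080 * (d * Real.log 2) := by
    intro i _
    rw [← Finset.mul_sum, Finset.sum_add_distrib, Finset.sum_range_sub', Finset.sum_range_sub']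
    have hS := log_steiner_sub_le hd (isCompact_sellerRegion (history A s b x 0))
      (sellerRegion_subset _) (isCompact_sellerRegion (history A s b x T))
      ⟨s, mem_sellerRegion_history A x 0 hs⟩ ⟨s, mem_sellerRegion_history A x T hs⟩ i
    have hB := log_steiner_sub_le hd (isCompact_buyerRegion (history A s b x 0))
      (buyerRegion_subset _) (isCompact_buyerRegion (history A s b x T))
      ⟨b, mem_buyerRegion_history A x 0 hb⟩ ⟨b, mem_buyerRegion_history A x T hb⟩ i
    calc _ ≤ 180 / 2 ^ i * (d * (Real.log (32 * d) + 3 * 2 ^ i * Real.log 2) +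
          d * (Real.log (32 * d) + 3 * 2 ^ i * Real.log 2)) := by gcongr
      _ = _ := by
        rw [one_div, inv_pow]
        field_simp
        ring
  refine (Finset.sum_le_sum h1).trans ?_
  rw [Finset.sum_add_distrib, ← Finset.mul_sum, Finset.sum_const, Finset.card_range, nsmul_eq_mul]
  have h2 : ∑ i ∈ Finset.range N, (1 / 2 : ℝ) ^ i ≤ 2 := sum_geometric_two_le N
  have h3 : 0 ≤ 360 * (d * Real.log (32 * d)) := by positivity
  nlinarith

theorem profitRegret_le {d T : ℕ} (hd : 1 ≤ d) (hT : 3 ≤ T) {A : TwoBitAlgorithm d}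
    (hA : UsesUnbalancedPrices T A) {s b : Vec d} {x : ℕ → Vec d} (hs : ‖s‖ ≤ 1) (hb : ‖b‖ ≤ 1)
    (hx : ∀ t < T, ‖x t‖ ≤ 1) :
    profitRegret A s b x T ≤ 100000 * (d * Real.log (Real.log T) + d * Real.log d) := by
  have hd' : (1 : ℝ) ≤ d := by exact_mod_cast hd
  have hT' : (0 : ℝ) < T := by exact_mod_cast (show 0 < T by omega)
  have h1 : profitRegret A s b x T ≤ ∑ t ∈ Finset.range T,
      (2 / (T : ℝ) + potentialDrop A s b x (Nat.log 2 (Nat.log 2 T) + 1) t) := by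
    rw [profitRegret, ← Finset.sum_sub_distrib]
    exact Finset.sum_le_sum fun t ht =>
      regret_round_le hd (by omega) hA hs hb hx (Finset.mem_range.1 ht)
  rw [Finset.sum_add_distrib, Finset.sum_const, Finset.card_range, nsmul_eq_mul,
    mul_div_cancel₀ _ hT'.ne'] at h1
  have h2 := sum_potentialDrop_le hd A x hs hb (Nat.log 2 (Nat.log 2 T) + 1) T
  have h3 := natLog_natLog_le hT
  have h4 := le_log_log hT
  have hlog2 := Real.log_two_lt_d9
  have hlog2' := Real.log_two_gt_d9
  have h5 : Real.log (32 * d) = 5 * Real.log 2 + Real.log d := by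
    rw [Real.log_mul (by norm_num) (by positivity), show (32 : ℝ) = 2 ^ 5 by norm_num,
      Real.log_pow]
    norm_num
  have h6 : 0 ≤ Real.log d := Real.log_nonneg hd'
  set L := Real.log (Real.log T)
  set M := Nat.log 2 (Nat.log 2 T)
  push_cast at h2
  have h7 : (d : ℝ) * ((M + 1) * Real.log 2) ≤ d * (L + 2) := by
    gcongr
    linarith
  have h8 : (d : ℝ) * Real.log (32 * d) ≤ d * (4 + Real.log d) := by
    rw [h5]
    gcongr
    linarith
  -- The leftover constants total at most `5042 d`, that is, at most `63025 d L`; this accounts for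
  -- most of the 100000.
  have h9 : (d : ℝ) * (8 / 100) ≤ d * L := by gcongr
  have h10 : 0 ≤ (d : ℝ) * Real.log d := by positivity
  linarith

end ContextualTrade

theorem theorem5p3 :
    ∃ C : ℝ, 0 < C ∧ ∀ d T : ℕ, 1 ≤ d → 3 ≤ T →
      ∃ A : TwoBitAlgorithm d, UsesUnbalancedPrices T A ∧
        ∀ (s b : Vec d) (x : ℕ → Vec d), ‖s‖ ≤ 1 → ‖b‖ ≤ 1 → (∀ t < T, ‖x t‖ ≤ 1) →
          BudgetBalanced A s b x T ∧
          profitRegret A s b x T ≤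
            C * (d * Real.log (Real.log T) + d * Real.log d) ∧
          SellerPotentialShrinks A s b x T ∧
          BuyerPotentialShrinks A s b x T := by
  refine ⟨100000, by norm_num, fun d T hd hT => ?_⟩
  obtain ⟨A, hA⟩ := exists_usesUnbalancedPrices hd T
  exact ⟨A, hA, fun s b x hs hb hx => ⟨budgetBalanced hA s b x,
    profitRegret_le hd hT hA hs hb hx, sellerPotentialShrinks hd hA hs hx,
    buyerPotentialShrinks hd hA hb hx⟩⟩
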